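/- Let $n\ge 3$. For integers $1<j<k\le n$ let $(1,j,k)$ denote the Boolean function $$x_1x_jx_k+x_2x_{j+1}x_{k+1}+\cdots+x_nx_{j-1}x_{k-1}$$ in $n$ variables over $GF(2)$, with subscripts read modulo $n$ in $\{1,\dots,n\}$; these functions are the cubic monomial rotation symmetric (MRS) functions in $n$ variables. A permutation $\sigma$ of $\{1,\dots,n\}$ acts on Boolean functions by replacing each $x_i$ by $x_{\sigma(i)}$; it preserves rotation symmetry if it takes every cubic MRS function to a function that is invariant under all cyclic shifts of the variables. Two cubic MRS functions are equivalent if a permutation which preserves rotation symmetry takes one to the other; the size of an equivalence class is the number of functions in it, and $E(n)$ is the number of equivalence classes. Let $D_n$ be the set of triples $(1,j,k)$ with $1<j<k\le n$ that are lexicographically least among all such triples giving the same function. **Theorem 5.7.** Suppose $n=3^k$ with $k\ge 1$. Then $E(3^k)=3^{k-1}$. There is at least one equivalence class of size $d$ for every divisor $d\ne 2$ of $\varphi(n)=2\cdot 3^{k-1}$, and there is no equivalence class of size $2$. For $0\le j\le k-1$ there is exactly one equivalence class of size $3^j$, and its least representative in the lexicographical ordering of $D_n$ is $(1,\,3^{k-j-1}+1,\,2\cdot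 3^{k-j-1}+1)$. For $1\le j\le k-1$ there are exactly $2\cdot 3^{j-1}-1$ equivalence classes of size $2\cdot 3^j$. -/

import Mathlib

/-- Boolean functions in the `n` variables `x₁, …, xₙ`. The variables are indexed by `ZMod n`, so that
subscripts are read modulo `n` (in particular `xₙ` is `x 0`). -/
abbrev BoolFun (n : ℕ) : Type := (ZMod n → ZMod 2) → ZMod 2

/-- The cubic function `(1, j, k)`, that is
`x₁ xⱼ xₖ + x₂ xⱼ₊₁ xₖ₊₁ + ⋯ + xₙ xⱼ₋₁ xₖ₋₁`, with addition modulo 2. For the short function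
`(1, n/3 + 1, 2n/3 + 1)` every monomial occurs three times in this sum, so that modulo 2 the sum
reduces to that of its `n/3` distinct monomials. -/
def mrs (n : ℕ) [NeZero n] (j k : ℕ) : BoolFun n := fun x =>
  ∑ i : ZMod n, x i * x (i + ((j : ZMod n) - 1)) * x (i + ((k : ZMod n) - 1))

/-- The set `Cₙ` of cubic monomial rotation symmetric functions in `n` variables. -/
def cubicMRS (n : ℕ) [NeZero n] : Set (BoolFun n) :=
  {f | ∃ j k : ℕ, 1 < j ∧ j < k ∧ k ≤ n ∧ f = mrs n j k}

/-- The action of a permutation of the variables: `xᵢ` is replaced by `x_{σ(i)}`, so that the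
monomial `xₐ x_b x_c` becomes `x_{σ(a)} x_{σ(b)} x_{σ(c)}`. -/
def permute {n : ℕ} (σ : Equiv.Perm (ZMod n)) (f : BoolFun n) : BoolFun n := fun x => f (x ∘ σ)

/-- A Boolean function is rotation symmetric if every cyclic shift of the variables fixes it. -/
def RotationSymmetric {n : ℕ} (f : BoolFun n) : Prop :=
  ∀ c : ZMod n, permute (Equiv.addRight c) f = f

/-- The permutation `σ` preserves rotation symmetry: it takes every cubic monomial rotation
symmetric function to a rotation symmetric function. -/
def PreservesRotationSymmetry {n : ℕ} [NeZero n] (σ : Equiv.Perm (ZMod n)) : Prop :=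
  ∀ f ∈ cubicMRS n, RotationSymmetric (permute σ f)

/-- The equivalence class of `f`: all cubic monomial rotation symmetric functions obtained from `f`
by a permutation of the variables which preserves rotation symmetry. -/
def equivClass {n : ℕ} [NeZero n] (f : BoolFun n) : Set (BoolFun n) :=
  {g | g ∈ cubicMRS n ∧
    ∃ σ : Equiv.Perm (ZMod n), PreservesRotationSymmetry σ ∧ permute σ f = g}

/-- The set of all equivalence classes of cubic monomial rotation symmetric functions. -/
def equivClasses (n : ℕ) [NeZero n] : Set (Set (BoolFun n)) :=
  equivClass '' cubicMRS n

/-- The number `E(n)` of equivalence classes. -/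
noncomputable def numClasses (n : ℕ) [NeZero n] : ℕ := (equivClasses n).ncard

/-- The pairs `(j, k)`, `1 < j < k ≤ n`, with `(1, j, k) = f`, ordered lexicographically. -/
def representations {n : ℕ} [NeZero n] (f : BoolFun n) : Set (ℕ ×ₗ ℕ) :=
  {t | 1 < (ofLex t).1 ∧ (ofLex t).1 < (ofLex t).2 ∧ (ofLex t).2 ≤ n ∧
    mrs n (ofLex t).1 (ofLex t).2 = f}

/-- The set `Dₙ` of normalized triples `(1, j, k)`, written as pairs `(j, k)`: each function is
represented by the triple with least `j` and, given that, with least `k`. -/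
def normalForms (n : ℕ) [NeZero n] : Set (ℕ ×ₗ ℕ) :=
  {t | ∃ f : BoolFun n, IsLeast (representations f) t}

/-- `(1, j, k)` is the least element, in the lexicographical ordering of `Dₙ`, among the elements of
`Dₙ` whose function lies in the class `c`. -/
def IsLeastRepresentative {n : ℕ} [NeZero n] (c : Set (BoolFun n)) (j k : ℕ) : Prop :=
  IsLeast {t : ℕ ×ₗ ℕ | t ∈ normalForms n ∧ mrs n (ofLex t).1 (ofLex t).2 ∈ c} (toLex (j, k))

/-! A cubic MRS function is a triple `{0, a, b}` up to translation, that is, an orbit `six a b` of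
pairs. If σ preserves rotation symmetry, its conjugates of shifts fix every cubic MRS function. For
odd n ≥ 7 only translations do that, so σ normalizes the translations and is affine; for n = 3 every
permutation is affine. Translations act trivially, so the classes are the orbits of the units modulo
`3 ^ k`.

The level j, where `3 ^ (j + 1)` is the exact annihilator of the pair, is invariant, and at level j
a unit acts through its residue modulo `3 ^ (j + 1)` (`Level.killed_iff`). A unit fixing the
function permutes the triple, up to translation. A 3-cycle forces u² + u + 1 = 0, impossible modulo
9. A transposition forces u = -1 and makes the triple an arithmetic progression; the progressions of
level j form a single orbit, that of `special k j`. This orbit has stabilizer ±1 and size `3 ^ j`;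
all others have trivial stabilizer modulo `3 ^ (j + 1)` and size `2 * 3 ^ j`. Counting the functions
of level j then gives the number of orbits. -/

/-- The sum of the monomials `xᵢ xᵢ₊ₐ xᵢ₊ᵦ` over all `i`. -/
def tri {n : ℕ} [NeZero n] (a b : ZMod n) : BoolFun n := fun x =>
  ∑ i : ZMod n, x i * x (i + a) * x (i + b)

/-- The points `0, a, b` are distinct. -/
def Proper {n : ℕ} (a b : ZMod n) : Prop := a ≠ 0 ∧ b ≠ 0 ∧ a ≠ b

/-- The pairs `(a', b')` such that `{0, a', b'}` is a translate of `{0, a, b}`. -/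
def six {n : ℕ} (a b : ZMod n) : Finset (ZMod n × ZMod n) :=
  {(a, b), (b, a), (-a, b - a), (b - a, -a), (-b, a - b), (a - b, -b)}

/-! ### Cubic MRS functions as triples up to translation -/

section Basic

variable {n : ℕ}

theorem mem_six {a b a' b' : ZMod n} : (a', b') ∈ six a b ↔
    (a' = a ∧ b' = b) ∨ (a' = b ∧ b' = a) ∨ (a' = -a ∧ b' = b - a) ∨ (a' = b - a ∧ b' = -a) ∨
    (a' = -b ∧ b' = a - b) ∨ (a' = a - b ∧ b' = -b) := by
  simp [six]

theorem proper_of_lt {j k : ℕ} (hj : 1 < j) (hjk : j < k) (hk : k ≤ n) :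
    Proper ((j : ZMod n) - 1) ((k : ZMod n) - 1) := by
  have key : ∀ a b : ℕ, a < b → b ≤ n → 0 < a → (b : ZMod n) - a ≠ 0 := by
    intro a b hab hb ha
    rw [← Nat.cast_sub hab.le, Ne, ZMod.natCast_eq_zero_iff]
    exact fun h => by have := Nat.le_of_dvd (by omega) h; omega
  refine ⟨by simpa using key 1 j hj (by omega) one_pos,
    by simpa using key 1 k (by omega) hk one_pos, fun h => key j k hjk hk (by omega) ?_⟩
  linear_combination -h

theorem natCast_ne_zero_of_lt {m : ℕ} (h0 : 0 < m) (h : m < n) : (m : ZMod n) ≠ 0 := by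
  rw [Ne, ZMod.natCast_eq_zero_iff]
  exact fun h' => by have := Nat.le_of_dvd h0 h'; omega

/-- The indicator function of `{p, q, r}`. -/
def ind (p q r : ZMod n) : ZMod n → ZMod 2 := fun i => if i = p ∨ i = q ∨ i = r then 1 else 0

theorem ind_ne_zero {p q r i : ZMod n} (h : ind p q r i ≠ 0) : i = p ∨ i = q ∨ i = r := by
  by_contra h'
  exact h (if_neg h')

variable [NeZero n]

theorem mrs_eq_tri (j k : ℕ) : mrs n j k = tri ((j : ZMod n) - 1) ((k : ZMod n) - 1) := rfl

theorem tri_comm (a b : ZMod n) : tri a b = tri b a := by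
  funext x
  exact Finset.sum_congr rfl fun i _ => by ring

theorem tri_neg (a b : ZMod n) : tri (-a) (b - a) = tri a b := by
  funext x
  refine Fintype.sum_equiv (Equiv.subRight a) _ _ fun i => ?_
  simp only [Equiv.subRight_apply, sub_add_cancel]
  rw [← sub_eq_add_neg, show i + (b - a) = i - a + b by ring]
  ring

theorem tri_of_mem_six {a b a' b' : ZMod n} (h : (a', b') ∈ six a b) : tri a' b' = tri a b := by
  rcases mem_six.1 h with ⟨rfl, rfl⟩ | ⟨rfl, rfl⟩ | ⟨rfl, rfl⟩ | ⟨rfl, rfl⟩ | ⟨rfl, rfl⟩ | ⟨rfl, rfl⟩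
  · rfl
  · exact tri_comm _ _
  · exact tri_neg _ _
  · rw [tri_comm, tri_neg]
  · rw [tri_neg, tri_comm]
  · rw [tri_comm, tri_neg, tri_comm]

/-- Indicators detect monomials: a nonzero value needs a monomial supported in `{p, q, r}`. -/
theorem exists_of_tri_ind_ne_zero {a b p q r : ZMod n} (h : tri a b (ind p q r) ≠ 0) :
    ∃ i, (i = p ∨ i = q ∨ i = r) ∧ (i + a = p ∨ i + a = q ∨ i + a = r) ∧
      (i + b = p ∨ i + b = q ∨ i + b = r) := by
  obtain ⟨i, -, hi⟩ := Finset.exists_ne_zero_of_sum_ne_zero h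
  exact ⟨i, ind_ne_zero (left_ne_zero_of_mul (left_ne_zero_of_mul hi)),
    ind_ne_zero (right_ne_zero_of_mul (left_ne_zero_of_mul hi)),
    ind_ne_zero (right_ne_zero_of_mul hi)⟩

/-- The nonzero terms correspond to the shifts preserving the triple. There is one, or three when
`{0, a, b}` is a subgroup of order 3 (the short function); either number is odd. -/
theorem tri_ind (h2 : ∀ a : ZMod n, 2 * a = 0 → a = 0) {a b : ZMod n} (h : Proper a b)
    (t : ZMod n) : tri a b (ind t (t + a) (t + b)) = 1 := by
  obtain ⟨ha, hb, hab⟩ := h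
  have hsupp : tri a b (ind t (t + a) (t + b)) = ∑ i ∈ ({t, t + a, t + b} : Finset (ZMod n)),
      ind t (t + a) (t + b) (i + a) * ind t (t + a) (t + b) (i + b) := by
    unfold tri
    rw [← Finset.sum_subset (Finset.subset_univ ({t, t + a, t + b} : Finset (ZMod n)))]
    · refine Finset.sum_congr rfl fun i hi => ?_
      have : ind t (t + a) (t + b) i = 1 := if_pos (by simpa using hi)
      rw [this, one_mul]
    · intro i _ hi
      have : ind t (t + a) (t + b) i = 0 := if_neg (by simpa using hi)
      rw [this, zero_mul, zero_mul]
  have h2a : a + a ≠ 0 := fun h => ha (h2 a (by rw [two_mul, h]))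
  have h2b : b + b ≠ 0 := fun h => hb (h2 b (by rw [two_mul, h]))
  rw [hsupp, Finset.sum_insert (by simp [ha, hb]), Finset.sum_insert (by simp [hab]),
    Finset.sum_singleton]
  by_cases hs : a + b = 0
  · obtain rfl : b = -a := by linear_combination hs
    have e1 : a + a = -a ↔ -a + -a = a := by
      constructor <;> intro h <;> linear_combination -h
    by_cases h3 : -a + -a = a
    · simp [ind, add_assoc, ha, hb, h3, e1.2 h3]
      decide
    · have h4 : ¬ a + a = -a := fun h => h3 (e1.1 h)
      have h5 : ¬ -a + -a = 0 := h2b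
      simp [ind, add_assoc, ha, hb, h2a, h3, h4, h5]
  · have hs' : b + a ≠ 0 := by rwa [add_comm]
    simp [ind, add_assoc, ha, hb, hs, hs']

theorem mem_six_of_tri_eq (h2 : ∀ a : ZMod n, 2 * a = 0 → a = 0) {a b a' b' : ZMod n}
    (h : Proper a b) (h' : Proper a' b') (e : tri a' b' = tri a b) : (a', b') ∈ six a b := by
  have h1 : tri a' b' (ind 0 (0 + a) (0 + b)) ≠ 0 := by
    rw [e, tri_ind h2 h]
    exact one_ne_zero
  obtain ⟨ha', hb', hab'⟩ := h'
  obtain ⟨i, hi, hia, hib⟩ := exists_of_tri_ind_ne_zero h1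
  rw [mem_six]
  simp only [zero_add] at hi hia hib
  rcases hi with rfl | rfl | rfl <;> rcases hia with hia | hia | hia <;>
    rcases hib with hib | hib | hib <;> grind

theorem tri_mem_cubicMRS {a b : ZMod n} (h : Proper a b) : tri a b ∈ cubicMRS n := by
  wlog hlt : a.val < b.val generalizing a b
  · rw [tri_comm]
    refine this ⟨h.2.1, h.1, h.2.2.symm⟩ (lt_of_le_of_ne (not_lt.1 hlt) fun e => ?_)
    exact h.2.2 (ZMod.val_injective n e.symm)
  · have := (ZMod.val_ne_zero a).2 h.1
    have := ZMod.val_lt b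
    refine ⟨a.val + 1, b.val + 1, by omega, by omega, by omega, ?_⟩
    simp [mrs_eq_tri]

theorem mem_cubicMRS {f : BoolFun n} : f ∈ cubicMRS n ↔ ∃ a b, Proper a b ∧ f = tri a b := by
  constructor
  · rintro ⟨j, k, hj, hjk, hk, rfl⟩
    exact ⟨_, _, proper_of_lt hj hjk hk, mrs_eq_tri j k⟩
  · rintro ⟨a, b, h, rfl⟩
    exact tri_mem_cubicMRS h

theorem permute_affine {σ : Equiv.Perm (ZMod n)} {u c : ZMod n} (hσ : ∀ x, σ x = u * x + c)
    (a b : ZMod n) : permute σ (tri a b) = tri (u * a) (u * b) := by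
  funext x
  refine Fintype.sum_equiv σ _ _ fun i => ?_
  simp only [Function.comp_apply, hσ]
  rw [show u * (i + a) + c = u * i + c + u * a by ring,
    show u * (i + b) + c = u * i + c + u * b by ring]

theorem rotationSymmetric_tri (a b : ZMod n) : RotationSymmetric (tri a b) := fun c => by
  rw [permute_affine (u := 1) (c := c) (by simp), one_mul, one_mul]

theorem preserves_of_affine {σ : Equiv.Perm (ZMod n)} {u c : ZMod n}
    (hσ : ∀ x, σ x = u * x + c) : PreservesRotationSymmetry σ := by
  intro f hf
  obtain ⟨a, b, -, rfl⟩ := mem_cubicMRS.1 hf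
  rw [permute_affine hσ]
  exact rotationSymmetric_tri _ _

/-! ### Permutations preserving rotation symmetry are affine -/

/-- The conjugates of the shifts by `σ` fix every cubic MRS function. -/
theorem PreservesRotationSymmetry.permute_conj {σ : Equiv.Perm (ZMod n)}
    (hσ : PreservesRotationSymmetry σ) {f : BoolFun n} (hf : f ∈ cubicMRS n) (c : ZMod n) :
    permute (σ⁻¹ * Equiv.addRight c * σ) f = f := by
  funext x
  have h := congrFun (hσ f hf c) (x ∘ ⇑σ⁻¹)
  simp only [permute] at h ⊢
  rw [show (x ∘ ⇑σ⁻¹) ∘ ⇑σ = x by funext i; simp] at h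
  exact h

/-- Evaluating at the indicator of the τ-image of a translate of `{0, a, b}` shows that this image
is again such a translate. -/
theorem exists_translate_of_permute_eq (h2 : ∀ a : ZMod n, 2 * a = 0 → a = 0)
    {τ : Equiv.Perm (ZMod n)} {a b : ZMod n} (h : Proper a b) (hτ : permute τ (tri a b) = tri a b)
    (t : ZMod n) :
    ∃ i, (i = τ t ∨ i = τ (t + a) ∨ i = τ (t + b)) ∧
      (i + a = τ t ∨ i + a = τ (t + a) ∨ i + a = τ (t + b)) ∧
      (i + b = τ t ∨ i + b = τ (t + a) ∨ i + b = τ (t + b)) := by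
  apply exists_of_tri_ind_ne_zero
  rw [← hτ]
  have : ind (τ t) (τ (t + a)) (τ (t + b)) ∘ τ = ind t (t + a) (t + b) := by
    funext i
    simp [ind]
  rw [permute, this, tri_ind h2 h]
  exact one_ne_zero

theorem eq_add_mul_of_step {τ : ZMod n → ZMod n} {e : ZMod n} (h : ∀ x, τ (x + 1) = τ x + e)
    (x : ZMod n) : τ x = e * x + τ 0 := by
  have key : ∀ m : ℕ, τ (m : ZMod n) = e * m + τ 0 := by
    intro m
    induction m with
    | zero => simp
    | succ m ih => rw [Nat.cast_succ, h, ih]; ring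
  simpa using key x.val

/-- A permutation which fixes every cubic MRS function is a translation. -/
theorem translation_of_permute_eq (hn : 7 ≤ n) (h2 : ∀ a : ZMod n, 2 * a = 0 → a = 0)
    {τ : Equiv.Perm (ZMod n)} (hτ : ∀ f ∈ cubicMRS n, permute τ f = f) (x : ZMod n) :
    τ x = x + τ 0 := by
  have n1 : (1 : ZMod n) ≠ 0 := by simpa using natCast_ne_zero_of_lt (n := n) (m := 1) (by omega) (by omega)
  have n2 : (2 : ZMod n) ≠ 0 := by simpa using natCast_ne_zero_of_lt (n := n) (m := 2) (by omega) (by omega)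
  have n3 : (3 : ZMod n) ≠ 0 := by simpa using natCast_ne_zero_of_lt (n := n) (m := 3) (by omega) (by omega)
  have n4 : (4 : ZMod n) ≠ 0 := by simpa using natCast_ne_zero_of_lt (n := n) (m := 4) (by omega) (by omega)
  have n5 : (5 : ZMod n) ≠ 0 := by simpa using natCast_ne_zero_of_lt (n := n) (m := 5) (by omega) (by omega)
  have p12 : Proper (1 : ZMod n) 2 := ⟨n1, n2, fun h => n1 (by linear_combination -h)⟩
  have p13 : Proper (1 : ZMod n) 3 := ⟨n1, n3, fun h => n2 (by linear_combination -h)⟩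
  have hne : ∀ x d : ZMod n, d ≠ 0 → τ (x + d) ≠ τ x := fun x d hd h => by
    simpa [hd] using τ.injective h
  -- Three consecutive points go to three consecutive points in some order: two of the images differ
  -- by ±1 unless the third is their midpoint.
  have hA : ∀ x, (τ (x + 1) = τ x + 1 ∨ τ (x + 1) = τ x - 1 ∨ 2 * τ (x + 2) = τ x + τ (x + 1)) ∧
      (τ (x + 2) = τ (x + 1) + 1 ∨ τ (x + 2) = τ (x + 1) - 1 ∨
        2 * τ x = τ (x + 1) + τ (x + 2)) := by
    intro x
    obtain ⟨i, h0, h1, h2⟩ := exists_translate_of_permute_eq h2 p12 (hτ _ (tri_mem_cubicMRS p12)) x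
    have e1 := hne x 1 n1
    have e2 := hne x 2 n2
    have e3 := hne (x + 1) 1 n1
    rw [show x + 1 + 1 = x + 2 by ring] at e3
    generalize τ x = p at *
    generalize τ (x + 1) = q at *
    generalize τ (x + 2) = r at *
    rcases h0 with h0 | h0 | h0 <;> rcases h1 with h1 | h1 | h1 <;>
      rcases h2 with h2 | h2 | h2 <;> grind
  have hB : ∀ x, τ (x + 1) = τ x + 1 ∨ τ (x + 1) = τ x - 1 := by
    intro x
    have h1 := (hA (x - 1)).2
    have h3 := (hA x).1
    rw [show x - 1 + 2 = x + 1 by ring, sub_add_cancel] at h1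
    rcases h1 with h1 | h1 | h1
    · exact .inl h1
    · exact .inr h1
    rcases h3 with h3 | h3 | h3
    · exact .inl h3
    · exact .inr h3
    -- Otherwise `τ (x - 1)` and `τ (x + 2)` are both the midpoint of `τ x` and `τ (x + 1)`, which
    -- is unique without 2-torsion.
    exfalso
    have h4 := h2 (τ (x + 2) - τ (x - 1)) (by linear_combination h3 - h1)
    refine hne (x - 1) 3 n3 ?_
    rw [show x - 1 + 3 = x + 2 by ring]
    linear_combination h4
  have hC : ∀ x, τ (x + 1 + 1) - τ (x + 1) = τ (x + 1) - τ x := by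
    intro x
    have e2 := hne x 2 n2
    rw [show x + 2 = x + 1 + 1 by ring] at e2
    rcases hB x with h | h <;> rcases hB (x + 1) with h' | h'
    · linear_combination h' - h
    · exact absurd (by linear_combination h + h') e2
    · exact absurd (by linear_combination h + h') e2
    · linear_combination h' - h
  have hD : ∀ x, τ (x + 1) - τ x = τ 1 - τ 0 := by
    intro x
    have := eq_add_mul_of_step (τ := fun x => τ (x + 1) - τ x) (e := 0)
      (fun x => by simpa using hC x) x
    simpa using this
  have hE := eq_add_mul_of_step (τ := τ) (e := τ 1 - τ 0) (fun x => by linear_combination hD x)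
  have hF : τ 1 - τ 0 = 1 ∨ τ 1 - τ 0 = -1 := by
    rcases hB 0 with h | h <;> rw [zero_add] at h
    · left; linear_combination h
    · right; linear_combination h
  rcases hF with hF | hF
  · rw [hE x, hF, one_mul]
  -- The triple `{0, 1, 3}` is not a translate of its reflection, which rules out slope -1.
  · exfalso
    rw [hF] at hE
    obtain ⟨i, h0, h1, h3⟩ := exists_translate_of_permute_eq h2 p13 (hτ _ (tri_mem_cubicMRS p13)) 0
    simp only [hE (0 + 1), hE (0 + 3)] at h0 h1 h3
    generalize τ 0 = c at *
    rcases h0 with h0 | h0 | h0 <;> rcases h1 with h1 | h1 | h1 <;>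
      rcases h3 with h3 | h3 | h3 <;> grind

theorem affine_of_preserves (hn : 7 ≤ n) (h2 : ∀ a : ZMod n, 2 * a = 0 → a = 0)
    {σ : Equiv.Perm (ZMod n)} (hσ : PreservesRotationSymmetry σ) :
    ∃ (u : (ZMod n)ˣ) (c : ZMod n), ∀ x, σ x = u * x + c := by
  have h := translation_of_permute_eq hn h2 (fun f hf => hσ.permute_conj hf 1)
  simp only [Equiv.Perm.mul_apply, Equiv.coe_addRight] at h
  set e := σ⁻¹ (σ 0 + 1) with he
  have hstep : ∀ y, σ⁻¹ (y + 1) = σ⁻¹ y + e := fun y => by simpa using h (σ⁻¹ y)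
  have hlin := eq_add_mul_of_step hstep
  set d := σ⁻¹ 0 with hd
  -- The inverse permutation is y ↦ ey + d; the preimage of 1 + d under it inverts e.
  have hu : e * (σ (1 + d)) = 1 := by
    have := hlin (σ (1 + d))
    simp only [Equiv.Perm.inv_def, Equiv.symm_apply_apply] at this
    linear_combination -this
  refine ⟨⟨σ (1 + d), e, by rw [mul_comm, hu], hu⟩, -(σ (1 + d) * d), fun x => ?_⟩
  have := hlin (σ x)
  simp only [Equiv.Perm.inv_def, Equiv.symm_apply_apply] at this
  simp only
  linear_combination -σ x * hu - σ (1 + d) * this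

end Basic

/-! ### Levels and the action of the units -/

section Action

variable {n : ℕ}

theorem six_symm {a b a' b' : ZMod n} (h : (a', b') ∈ six a b) : (a, b) ∈ six a' b' := by
  rw [mem_six] at h ⊢
  rcases h with ⟨rfl, rfl⟩ | ⟨rfl, rfl⟩ | ⟨rfl, rfl⟩ | ⟨rfl, rfl⟩ | ⟨rfl, rfl⟩ | ⟨rfl, rfl⟩ <;> simp

/-- Both `a` and `b` are annihilated by `r`. -/
def Killed (r a b : ZMod n) : Prop := r * a = 0 ∧ r * b = 0

theorem Killed.of_mem_six {r a b a' b' : ZMod n} (h : Killed r a b) (hs : (a', b') ∈ six a b) :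
    Killed r a' b' := by
  obtain ⟨h1, h2⟩ := h
  rcases mem_six.1 hs with ⟨rfl, rfl⟩ | ⟨rfl, rfl⟩ | ⟨rfl, rfl⟩ | ⟨rfl, rfl⟩ | ⟨rfl, rfl⟩ |
    ⟨rfl, rfl⟩ <;> simp [Killed, mul_sub, h1, h2]

theorem Proper.of_mem_six {a b a' b' : ZMod n} (h : Proper a b) (hs : (a', b') ∈ six a b) :
    Proper a' b' := by
  obtain ⟨h1, h2, h3⟩ := h
  rcases mem_six.1 hs with ⟨rfl, rfl⟩ | ⟨rfl, rfl⟩ | ⟨rfl, rfl⟩ | ⟨rfl, rfl⟩ | ⟨rfl, rfl⟩ |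
    ⟨rfl, rfl⟩ <;> refine ⟨?_, ?_, ?_⟩ <;> grind

theorem Proper.unit_mul {a b : ZMod n} (h : Proper a b) (u : (ZMod n)ˣ) :
    Proper ((u : ZMod n) * a) (u * b) := by
  obtain ⟨h1, h2, h3⟩ := h
  exact ⟨by simpa using h1, by simpa using h2, by simpa using h3⟩

/-- The pair `(a, b)` is proper, and `3 ^ (j + 1)` is the least power of `3` annihilating it. -/
def Level (j : ℕ) (a b : ZMod n) : Prop :=
  Proper a b ∧ Killed (3 ^ (j + 1)) a b ∧ ¬ Killed (3 ^ j) a b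

theorem Level.of_mem_six {j : ℕ} {a b a' b' : ZMod n} (h : Level j a b)
    (hs : (a', b') ∈ six a b) : Level j a' b' :=
  ⟨h.1.of_mem_six hs, h.2.1.of_mem_six hs, fun hk => h.2.2 (hk.of_mem_six (six_symm hs))⟩

theorem Level.unit_mul {j : ℕ} {a b : ZMod n} (h : Level j a b) (u : (ZMod n)ˣ) :
    Level j ((u : ZMod n) * a) (u * b) := by
  obtain ⟨h1, h2, h3⟩ := h
  refine ⟨h1.unit_mul u, ?_, ?_⟩
  · simpa [Killed, mul_left_comm _ (u : ZMod n)] using h2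
  · simpa [Killed, mul_left_comm _ (u : ZMod n)] using h3

variable [NeZero n]

/-- The units modulo `n` act on Boolean functions by scaling the indices of the variables. -/
instance unitsMulAction : MulAction (ZMod n)ˣ (BoolFun n) where
  smul u f := permute u.mulLeft f
  one_smul f := by
    funext x
    change f (x ∘ _) = f x
    congr 1
    funext i
    simp
  mul_smul u v f := by
    funext x
    change f (x ∘ _) = f ((x ∘ _) ∘ _)
    congr 1
    funext i
    simp [mul_assoc]

theorem smul_tri (u : (ZMod n)ˣ) (a b : ZMod n) : u • tri a b = tri ((u : ZMod n) * a) (u * b) :=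
  permute_affine (c := 0) (by simp) a b

theorem equivClass_eq_orbit
    (haff : ∀ σ : Equiv.Perm (ZMod n), PreservesRotationSymmetry σ →
      ∃ (u : (ZMod n)ˣ) (c : ZMod n), ∀ x, σ x = u * x + c)
    {f : BoolFun n} (hf : f ∈ cubicMRS n) :
    equivClass f = MulAction.orbit (ZMod n)ˣ f := by
  obtain ⟨a, b, hab, rfl⟩ := mem_cubicMRS.1 hf
  ext g
  constructor
  · rintro ⟨-, σ, hσ, rfl⟩
    obtain ⟨u, c, h⟩ := haff σ hσ
    exact ⟨u, by rw [permute_affine h]; exact smul_tri u a b⟩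
  · rintro ⟨u, rfl⟩
    have h : ∀ x, u.mulLeft x = u * x + 0 := by simp
    refine ⟨?_, u.mulLeft, preserves_of_affine h, rfl⟩
    change u • tri a b ∈ _
    rw [smul_tri]
    exact tri_mem_cubicMRS (hab.unit_mul u)

end Action

/-! ### Stabilizers and orbit sizes modulo powers of 3 -/

section PowThree

theorem isUnit_of_cast_ne_zero {m : ℕ} {x : ZMod (3 ^ (m + 1))}
    (hx : ZMod.castHom (dvd_pow_self 3 m.succ_ne_zero) (ZMod 3) x ≠ 0) : IsUnit x := by
  rw [← ZMod.natCast_zmod_val x] at hx ⊢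
  rw [map_natCast, Ne, ZMod.natCast_eq_zero_iff] at hx
  rw [ZMod.isUnit_iff_coprime]
  exact Nat.Coprime.pow_right _ (((Nat.Prime.coprime_iff_not_dvd Nat.prime_three).2 hx).symm)

/-- The factors v + 1 and v - 1 are not both divisible by 3, so one of them is a unit. -/
theorem eq_or_eq_neg_of_mul_self {m : ℕ} {v : ZMod (3 ^ (m + 1))} (hv : v * v = 1) :
    v = 1 ∨ v = -1 := by
  set π := ZMod.castHom (dvd_pow_self 3 m.succ_ne_zero) (ZMod 3)
  have h3 : ∀ w : ZMod 3, w * w = 1 → w + 1 ≠ 0 ∨ w - 1 ≠ 0 := by decide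
  have hv' : (v + 1) * (v - 1) = 0 := by linear_combination hv
  rcases h3 (π v) (by rw [← map_mul, hv, map_one]) with h | h
  · left
    have hu : IsUnit (v + 1) := isUnit_of_cast_ne_zero (by simpa [π] using h)
    exact sub_eq_zero.1 (hu.mul_right_eq_zero.1 hv')
  · right
    have hu : IsUnit (v - 1) := isUnit_of_cast_ne_zero (by simpa [π] using h)
    exact eq_neg_of_add_eq_zero_left (hu.mul_left_eq_zero.1 hv')

theorem cyclotomic_three_ne_zero {m : ℕ} (hm : 1 ≤ m) (v : ZMod (3 ^ (m + 1))) :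
    v * v + v + 1 ≠ 0 := by
  intro h
  have h9 : ∀ w : ZMod 9, w * w + w + 1 ≠ 0 := by decide
  have hd : 9 ∣ 3 ^ (m + 1) := pow_dvd_pow 3 (by omega : 2 ≤ m + 1)
  apply h9 (ZMod.castHom hd (ZMod 9) v)
  rw [← map_mul, ← map_add, ← map_one (ZMod.castHom hd (ZMod 9)), ← map_add, h, map_zero]

variable {k : ℕ}

theorem two_mul_eq_zero {a : ZMod (3 ^ k)} (h : 2 * a = 0) : a = 0 := by
  have h2 : IsUnit ((2 : ℕ) : ZMod (3 ^ k)) := by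
    rw [ZMod.isUnit_iff_coprime]
    exact Nat.Coprime.pow_right _ (by norm_num)
  exact h2.mul_right_eq_zero.1 (by exact_mod_cast h)

theorem affine_of_preserves_pow_three (hk : 1 ≤ k) {σ : Equiv.Perm (ZMod (3 ^ k))}
    (hσ : PreservesRotationSymmetry σ) :
    ∃ (u : (ZMod (3 ^ k))ˣ) (c : ZMod (3 ^ k)), ∀ x, σ x = u * x + c := by
  rcases Nat.lt_or_ge 1 k with h | h
  · refine affine_of_preserves ?_ (fun _ => two_mul_eq_zero) hσ
    have : 3 ^ 2 ≤ 3 ^ k := Nat.pow_le_pow_right (by norm_num) h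
    omega
  · obtain rfl : k = 1 := by omega
    clear hσ
    -- All six permutations of `ZMod 3` are affine.
    have key : ∀ σ : Equiv.Perm (ZMod 3), ∃ (u : (ZMod 3)ˣ) (c : ZMod 3),
        ∀ x, σ x = u * x + c := by decide
    exact key σ

theorem three_pow_eq_zero_iff {i : ℕ} : (3 : ZMod (3 ^ k)) ^ i = 0 ↔ k ≤ i := by
  have := ZMod.natCast_eq_zero_iff (3 ^ i) (3 ^ k)
  rw [Nat.pow_dvd_pow_iff_le_right (by norm_num)] at this
  rw [← this]
  simp

theorem exists_level {a b : ZMod (3 ^ k)} (h : Proper a b) : ∃ j < k, Level j a b := by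
  classical
  have hk : Killed (3 ^ k) a b := by simp [Killed, three_pow_eq_zero_iff.2 le_rfl]
  have hex : ∃ l, Killed (3 ^ l) a b := ⟨k, hk⟩
  have h0 : Nat.find hex ≠ 0 := fun h0 => by
    have := Nat.find_spec hex
    rw [h0] at this
    exact h.1 (by simpa using this.1)
  obtain ⟨j, hj⟩ := Nat.exists_eq_succ_of_ne_zero h0
  have hle := Nat.find_min' hex hk
  refine ⟨j, by omega, h, by simpa [hj] using Nat.find_spec hex, Nat.find_min hex (by omega)⟩

/-- An element annihilated by `3 ^ (j + 1)` but not by `3 ^ j` is a unit multiple of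
`3 ^ (k - 1 - j)`. -/
theorem exists_unit_mul {j : ℕ} {c : ZMod (3 ^ k)} (h1 : 3 ^ (j + 1) * c = 0)
    (h2 : 3 ^ j * c ≠ 0) : ∃ u : (ZMod (3 ^ k))ˣ, c = u * 3 ^ (k - 1 - j) := by
  have hc : c.val ≠ 0 := fun h => h2 (by rw [(ZMod.val_eq_zero c).1 h, mul_zero])
  obtain ⟨m, w, hw, hcw⟩ := Nat.exists_eq_pow_mul_and_not_dvd hc 3 (by norm_num)
  have hu : IsUnit (w : ZMod (3 ^ k)) := by
    rw [ZMod.isUnit_iff_coprime]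
    exact Nat.Coprime.pow_right _ (((Nat.Prime.coprime_iff_not_dvd Nat.prime_three).2 hw).symm)
  obtain ⟨u, hu⟩ := hu
  have hc' : c = 3 ^ m * u := by
    rw [← ZMod.natCast_zmod_val c, hcw, hu]
    push_cast
    rfl
  rw [hc', ← mul_assoc, ← pow_add, Units.mul_left_eq_zero, three_pow_eq_zero_iff] at h1
  rw [hc', ← mul_assoc, ← pow_add, Ne, Units.mul_left_eq_zero, three_pow_eq_zero_iff] at h2
  exact ⟨u, by rw [hc', mul_comm, show m = k - 1 - j by omega]⟩

variable {j : ℕ}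

/-- Reduction modulo `3 ^ (j + 1)`. -/
abbrev red (hj : j < k) : ZMod (3 ^ k) →+* ZMod (3 ^ (j + 1)) :=
  ZMod.castHom (pow_dvd_pow 3 (show j + 1 ≤ k from hj)) _

/-- One of a, b has additive order exactly `3 ^ (j + 1)`, and that order kills both. -/
theorem Level.killed_iff (hj : j < k) {a b : ZMod (3 ^ k)} (h : Level j a b) (r : ZMod (3 ^ k)) :
    Killed r a b ↔ red hj r = 0 := by
  obtain ⟨-, ⟨ha, hb⟩, hab⟩ := h
  rw [← ZMod.natCast_zmod_val r]
  generalize r.val = r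
  rw [map_natCast, ZMod.natCast_eq_zero_iff]
  have key : ∀ c : ZMod (3 ^ k), 3 ^ (j + 1) * c = 0 → 3 ^ j * c ≠ 0 → (r : ZMod (3 ^ k)) * c = 0 →
      3 ^ (j + 1) ∣ r := by
    intro c h1 h2 h3
    have : Fact (Nat.Prime 3) := ⟨Nat.prime_three⟩
    have ho := addOrderOf_eq_prime_pow (x := c) (p := 3) (n := j)
      (by simpa [nsmul_eq_mul] using h2) (by simpa [nsmul_eq_mul] using h1)
    rw [← ho, addOrderOf_dvd_iff_nsmul_eq_zero, nsmul_eq_mul, h3]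
  constructor
  · rintro ⟨h1, h2⟩
    by_cases h3 : (3 : ZMod (3 ^ k)) ^ j * a = 0
    · exact key b hb (fun h4 => hab ⟨h3, h4⟩) h2
    · exact key a ha h3 h1
  · rintro ⟨s, rfl⟩
    push_cast
    constructor
    · rw [mul_right_comm, ha, zero_mul]
    · rw [mul_right_comm, hb, zero_mul]

/-- The function `x₁ xⱼ xₖ + ⋯` for the triple `0, g, -g` with `g = 3 ^ (k - 1 - j)`. -/
def special (k j : ℕ) : BoolFun (3 ^ k) := tri (3 ^ (k - 1 - j)) (-3 ^ (k - 1 - j))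

theorem level_special (hj : j < k) :
    Level j (3 ^ (k - 1 - j) : ZMod (3 ^ k)) (-3 ^ (k - 1 - j)) := by
  have h0 : (3 ^ (k - 1 - j) : ZMod (3 ^ k)) ≠ 0 := by
    rw [Ne, three_pow_eq_zero_iff]; omega
  refine ⟨⟨h0, neg_ne_zero.2 h0, fun h => h0 (two_mul_eq_zero (by linear_combination h))⟩, ?_, ?_⟩
  · simp only [Killed, mul_neg, neg_eq_zero, ← pow_add, three_pow_eq_zero_iff]
    omega
  · simp only [Killed, mul_neg, neg_eq_zero, ← pow_add, three_pow_eq_zero_iff]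
    omega

theorem Level.mem_orbit_special {a : ZMod (3 ^ k)} (h : Level j a (-a)) :
    tri a (-a) ∈ MulAction.orbit (ZMod (3 ^ k))ˣ (special k j) := by
  obtain ⟨-, ⟨h1, -⟩, h3⟩ := h
  obtain ⟨u, rfl⟩ := exists_unit_mul h1 (fun h => h3 ⟨h, by rw [mul_neg, h, neg_zero]⟩)
  refine ⟨u, ?_⟩
  change u • special k j = _
  rw [special, smul_tri, mul_neg]

/-- The ratio of a and b matters only modulo 3, where it is ±1; the value 1 would give a = b. -/
theorem Level.eq_neg_of_zero (hk : 0 < k) {a b : ZMod (3 ^ k)} (h : Level 0 a b) : b = -a := by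
  have hkil := h.killed_iff hk
  obtain ⟨⟨ha0, hb0, hab⟩, ⟨ha, hb⟩, -⟩ := h
  obtain ⟨u, hu⟩ := exists_unit_mul ha (by simpa using ha0)
  obtain ⟨v, hv⟩ := exists_unit_mul hb (by simpa using hb0)
  have hb' : b = (u⁻¹ * v : (ZMod (3 ^ k))ˣ) * a := by
    rw [hv, hu, Units.val_mul]
    linear_combination (-(v * 3 ^ (k - 1 - 0)) : ZMod (3 ^ k)) * u.inv_mul
  set w := u⁻¹ * v
  have h3 : ∀ x : (ZMod 3)ˣ, (x : ZMod 3) = 1 ∨ (x : ZMod 3) = -1 := by decide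
  rcases h3 (Units.map (red hk).toMonoidHom w) with h | h
  · have := ((hkil (w - 1)).2 (by rw [map_sub, map_one]; exact sub_eq_zero.2 h)).1
    exact absurd (by linear_combination -hb' - this) hab
  · have := ((hkil (w + 1)).2 (by rw [map_add, map_one]; exact add_eq_zero_iff_eq_neg.2 h)).1
    linear_combination hb' + this

theorem Level.eq_neg_of_swap (hj : j < k) {a b : ZMod (3 ^ k)} (h : Level j a b)
    {u : (ZMod (3 ^ k))ˣ} (h1 : u * a = b) (h2 : u * b = a) : b = -a := by
  have hkil := h.killed_iff hj
  have hv : red hj u * red hj u = 1 := by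
    have := (hkil (u * u - 1)).1 ⟨by linear_combination u * h1 + h2, by linear_combination u * h2 + h1⟩
    rwa [map_sub, map_mul, map_one, sub_eq_zero] at this
  rcases eq_or_eq_neg_of_mul_self hv with h | h
  · have := ((hkil (u - 1)).2 (by rw [map_sub, map_one, h, sub_self])).1
    exact absurd (by linear_combination h1 - this) ‹Level j a b›.1.2.2
  · have := ((hkil (u + 1)).2 (by rw [map_add, map_one, h, neg_add_cancel])).1
    linear_combination -h1 + this

theorem smul_tri_eq_iff {a b : ZMod (3 ^ k)} (h : Proper a b) (u : (ZMod (3 ^ k))ˣ) :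
    u • tri a b = tri a b ↔ ((u * a : ZMod (3 ^ k)), (u * b : ZMod (3 ^ k))) ∈ six a b := by
  rw [smul_tri]
  exact ⟨mem_six_of_tri_eq (fun _ => two_mul_eq_zero) h (h.unit_mul u), tri_of_mem_six⟩

/-- Away from the special orbit, only the units which are `1` modulo `3 ^ (j + 1)` fix a function
of level `j`. -/
theorem Level.smul_eq_iff (hj : j < k) {a b : ZMod (3 ^ k)} (h : Level j a b)
    (hs : tri a b ∉ MulAction.orbit (ZMod (3 ^ k))ˣ (special k j)) :
    1 ≤ j ∧ ∀ u : (ZMod (3 ^ k))ˣ, u • tri a b = tri a b ↔ red hj u = 1 := by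
  have hneg : ∀ {a' b'}, (a', b') ∈ six a b → b' ≠ -a' := by
    rintro a' b' hm rfl
    exact hs (tri_of_mem_six hm ▸ (h.of_mem_six hm).mem_orbit_special)
  have hj1 : 1 ≤ j := by
    by_contra hj0
    obtain rfl : j = 0 := by omega
    exact hneg (a' := a) (b' := b) (by simp [six]) (h.eq_neg_of_zero hj)
  have hkil := h.killed_iff hj
  refine ⟨hj1, fun u => ?_⟩
  rw [smul_tri_eq_iff h.1]
  constructor
  · intro hm
    have hcyc : u * u * a + u * a + a = 0 → u * u * b + u * b + b = 0 → False := fun e1 e2 => by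
      apply cyclotomic_three_ne_zero hj1 (red hj u)
      rw [← map_mul, ← map_add, ← map_one (red hj), ← map_add, ← hkil]
      exact ⟨by linear_combination e1, by linear_combination e2⟩
    -- In order: the identity, transpositions fixing 0 and b, the two 3-cycles, the transposition
    -- fixing a. Moving the fixed point to 0 reduces each transposition to `Level.eq_neg_of_swap`.
    rcases mem_six.1 hm with ⟨h1, h2⟩ | ⟨h1, h2⟩ | ⟨h1, h2⟩ | ⟨h1, h2⟩ | ⟨h1, h2⟩ | ⟨h1, h2⟩
    · rw [← sub_eq_zero, ← map_one (red hj), ← map_sub, ← hkil]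
      exact ⟨by linear_combination h1, by linear_combination h2⟩
    · exact absurd (h.eq_neg_of_swap hj h1 h2) (hneg (a' := a) (b' := b) (by simp [six]))
    · have hm' : (-b, a - b) ∈ six a b := by simp [six]
      exact absurd ((h.of_mem_six hm').eq_neg_of_swap hj (u := u) (by linear_combination -h2)
        (by linear_combination h1 - h2)) (hneg hm')
    · exact (hcyc (by linear_combination u * h1 + h2)
        (by linear_combination (u + 1) * h2 - h1)).elim
    · exact (hcyc (by linear_combination (u + 1) * h1 - h2)
        (by linear_combination u * h2 + h1)).elim
    · have hm' : (-a, b - a) ∈ six a b := by simp [six]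
      exact absurd ((h.of_mem_six hm').eq_neg_of_swap hj (u := u) (by linear_combination -h1)
        (by linear_combination h2 - h1)) (hneg hm')
  · intro hu
    obtain ⟨h1, h2⟩ := (hkil (u - 1)).2 (by rw [map_sub, map_one, hu, sub_self])
    exact mem_six.2 (.inl ⟨by linear_combination h1, by linear_combination h2⟩)

theorem smul_special_eq_iff (hj : j < k) (u : (ZMod (3 ^ k))ˣ) :
    u • special k j = special k j ↔ red hj u = 1 ∨ red hj u = -1 := by
  have h := level_special hj
  have hkil := h.killed_iff hj
  rw [special, smul_tri_eq_iff h.1, mem_six]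
  generalize (3 ^ (k - 1 - j) : ZMod (3 ^ k)) = g at *
  have e1 : red hj u = 1 ↔ u * g = g := by
    rw [← sub_eq_zero, ← map_one (red hj), ← map_sub, ← hkil]
    constructor
    · rintro ⟨h1, h2⟩
      linear_combination h1
    · intro h1
      exact ⟨by linear_combination h1, by linear_combination -h1⟩
  have e2 : red hj u = -1 ↔ u * g = -g := by
    rw [← add_eq_zero_iff_eq_neg, ← map_one (red hj), ← map_add, ← hkil]
    constructor
    · rintro ⟨h1, h2⟩
      linear_combination h1
    · intro h1
      exact ⟨by linear_combination h1, by linear_combination -h1⟩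
  rw [e1, e2]
  constructor
  · rintro (⟨h1, h2⟩ | ⟨h1, h2⟩ | ⟨h1, h2⟩ | ⟨h1, h2⟩ | ⟨h1, h2⟩ | ⟨h1, h2⟩)
    · exact .inl h1
    · exact .inr h1
    · exact .inr h1
    · exact .inl (by linear_combination -h2)
    · exact .inl (by linear_combination h1)
    · exact .inr (by linear_combination -h2)
  · rintro (h1 | h1)
    · exact .inl ⟨h1, by linear_combination -h1⟩
    · exact .inr (.inl ⟨h1, by linear_combination -h1⟩)

theorem red_val_eq (hj : j < k) (u : (ZMod (3 ^ k))ˣ) :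
    red hj u = (ZMod.unitsMap (pow_dvd_pow 3 (show j + 1 ≤ k from hj)) u : ZMod (3 ^ (j + 1))) := rfl

theorem ncard_orbit_of_notMem (hj : j < k) {a b : ZMod (3 ^ k)} (h : Level j a b)
    (hs : tri a b ∉ MulAction.orbit (ZMod (3 ^ k))ˣ (special k j)) :
    1 ≤ j ∧ (MulAction.orbit (ZMod (3 ^ k))ˣ (tri a b)).ncard = 2 * 3 ^ j := by
  obtain ⟨hj1, hu⟩ := h.smul_eq_iff hj hs
  refine ⟨hj1, ?_⟩
  have hstab : MulAction.stabilizer (ZMod (3 ^ k))ˣ (tri a b) =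
      (ZMod.unitsMap (pow_dvd_pow 3 (show j + 1 ≤ k from hj))).ker := by
    ext u
    rw [MulAction.mem_stabilizer_iff, hu, red_val_eq, Units.val_eq_one, MonoidHom.mem_ker]
  rw [← MulAction.index_stabilizer, hstab, Subgroup.index_ker,
    MonoidHom.range_eq_top.2 (ZMod.unitsMap_surjective _), Subgroup.card_top,
    Nat.card_eq_fintype_card, ZMod.card_units_eq_totient,
    Nat.totient_prime_pow_succ Nat.prime_three, mul_comm]

theorem ncard_orbit_special (hj : j < k) :
    (MulAction.orbit (ZMod (3 ^ k))ˣ (special k j)).ncard = 3 ^ j := by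
  have hne : (-1 : (ZMod (3 ^ (j + 1)))ˣ) ≠ 1 := fun h => by
    have h1 : (1 : ZMod (3 ^ (j + 1))) = 0 := two_mul_eq_zero (by
      have := congrArg Units.val h
      rw [Units.val_neg, Units.val_one] at this
      linear_combination -this)
    have h3 := (three_pow_eq_zero_iff (k := j + 1) (i := 0)).1 (by simpa using h1)
    omega
  have : Fact (Nat.Prime 2) := ⟨Nat.prime_two⟩
  have ho : orderOf (-1 : (ZMod (3 ^ (j + 1)))ˣ) = 2 := orderOf_eq_prime (by simp) hne
  have hval : ∀ v : (ZMod (3 ^ (j + 1)))ˣ, (v : ZMod (3 ^ (j + 1))) = -1 ↔ v = -1 := fun v => by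
    rw [Units.ext_iff, Units.val_neg, Units.val_one]
  have hstab : MulAction.stabilizer (ZMod (3 ^ k))ˣ (special k j) =
      (Subgroup.zpowers (-1 : (ZMod (3 ^ (j + 1)))ˣ)).comap
        (ZMod.unitsMap (pow_dvd_pow 3 (show j + 1 ≤ k from hj))) := by
    ext u
    rw [MulAction.mem_stabilizer_iff, smul_special_eq_iff hj, red_val_eq, Subgroup.mem_comap,
      mem_zpowers_iff_mem_range_orderOf, ho, Units.val_eq_one, hval]
    simp [Finset.range_add_one, eq_comm, or_comm]
  have hcard := (Subgroup.zpowers (-1 : (ZMod (3 ^ (j + 1)))ˣ)).card_mul_index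
  rw [Nat.card_zpowers, ho, Nat.card_eq_fintype_card, ZMod.card_units_eq_totient,
    Nat.totient_prime_pow_succ Nat.prime_three] at hcard
  rw [← MulAction.index_stabilizer, hstab,
    Subgroup.index_comap_of_surjective _ (ZMod.unitsMap_surjective _)]
  omega

end PowThree

/-! ### Counting functions and classes level by level -/

section Counting

open Finset

open scoped Classical in
/-- The pairs of level `j`. -/
noncomputable def levelPairs (k j : ℕ) : Finset (ZMod (3 ^ k) × ZMod (3 ^ k)) :=
  {p | Level j p.1 p.2}

variable {k j : ℕ}

theorem mem_levelPairs {p : ZMod (3 ^ k) × ZMod (3 ^ k)} :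
    p ∈ levelPairs k j ↔ Level j p.1 p.2 := by
  simp [levelPairs]

theorem card_killed {l : ℕ} (hl : l ≤ k) :
    #{a : ZMod (3 ^ k) | 3 ^ l * a = 0} = 3 ^ l := by
  have h := IsAddCyclic.card_nsmulAddMonoidHom_ker (ZMod (3 ^ k)) (3 ^ l)
  rw [Nat.card_zmod, Nat.gcd_eq_right (pow_dvd_pow 3 hl)] at h
  rw [← h, Nat.subtype_card]
  intro a
  simp [AddMonoidHom.mem_ker, nsmul_eq_mul]

theorem levelPairs_eq : levelPairs k j =
    (({a : ZMod (3 ^ k) | 3 ^ (j + 1) * a = 0} : Finset _).erase 0).offDiag \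
      (({a : ZMod (3 ^ k) | 3 ^ j * a = 0} : Finset _).erase 0).offDiag := by
  ext ⟨a, b⟩
  simp only [mem_levelPairs, Level, Proper, Killed, mem_sdiff, mem_offDiag, mem_erase, mem_filter,
    mem_univ, true_and]
  tauto

theorem card_levelPairs (hj : j < k) : #(levelPairs k j) +
    (3 ^ j - 1) * (3 ^ j - 2) = (3 ^ (j + 1) - 1) * (3 ^ (j + 1) - 2) := by
  -- At l = 0 truncated subtraction gives 0 * 0, the correct count.
  have hoff : ∀ l ≤ k, #((({a : ZMod (3 ^ k) | 3 ^ l * a = 0} : Finset _).erase 0).offDiag) =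
      (3 ^ l - 1) * (3 ^ l - 2) := by
    intro l hl
    rw [offDiag_card, card_erase_of_mem (by simp), card_killed hl, ← Nat.mul_sub_one]
    rfl
  have hsub : (({a : ZMod (3 ^ k) | 3 ^ j * a = 0} : Finset _).erase 0).offDiag ⊆
      (({a : ZMod (3 ^ k) | 3 ^ (j + 1) * a = 0} : Finset _).erase 0).offDiag := by
    refine offDiag_mono (erase_subset_erase _ fun a ha => ?_)
    simp only [mem_filter, mem_univ, true_and] at ha ⊢
    rw [pow_succ', mul_assoc, ha, mul_zero]
  rw [levelPairs_eq, ← hoff j hj.le, ← hoff (j + 1) hj]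
  exact card_sdiff_add_card_eq_card hsub

/-- A coincidence through a transposition contradicts properness, as there is no 2-torsion; one
through a 3-cycle gives 3a = 3b = 0, so level 0. -/
theorem Level.card_six (hj1 : 1 ≤ j) {a b : ZMod (3 ^ k)} (h : Level j a b) :
    #(six a b) = 6 := by
  obtain ⟨⟨ha, hb, hab⟩, -, hk⟩ := h
  have h3 : ¬ (3 * a = 0 ∧ 3 * b = 0) := fun h3 => hk (by
    obtain ⟨i, rfl⟩ := Nat.exists_eq_succ_of_ne_zero (by omega : j ≠ 0)
    simp [Killed, pow_succ, mul_assoc, h3.1, h3.2])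
  have ha2 : 2 * a ≠ 0 := fun h => ha (two_mul_eq_zero h)
  have hb2 : 2 * b ≠ 0 := fun h => hb (two_mul_eq_zero h)
  have hab2 : 2 * (a - b) ≠ 0 := fun h => hab (sub_eq_zero.1 (two_mul_eq_zero h))
  unfold six
  repeat rw [card_insert_of_notMem]
  · simp
  all_goals
    simp only [mem_insert, mem_singleton, Prod.mk.injEq, not_or, not_and]
    grind

open scoped Classical in
/-- The functions of level `j`. -/
noncomputable def levelFuns (k j : ℕ) : Finset (BoolFun (3 ^ k)) :=
  (levelPairs k j).image fun p => tri p.1 p.2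

theorem mem_levelFuns {f : BoolFun (3 ^ k)} :
    f ∈ levelFuns k j ↔ ∃ a b, Level j a b ∧ tri a b = f := by
  simp [levelFuns, mem_levelPairs]

theorem card_levelPairs_eq_mul (hj1 : 1 ≤ j) : #(levelPairs k j) = 6 * #(levelFuns k j) := by
  classical
  rw [card_eq_sum_card_image (fun p => tri p.1 p.2), sum_const_nat (m := 6), mul_comm]
  · rfl
  · intro f hf
    obtain ⟨⟨a, b⟩, hab, rfl⟩ := mem_image.1 hf
    rw [mem_levelPairs] at hab
    rw [← hab.card_six hj1]
    congr 1
    ext ⟨a', b'⟩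
    rw [mem_filter, mem_levelPairs]
    exact ⟨fun h => mem_six_of_tri_eq (fun _ => two_mul_eq_zero) hab.1 h.1.1 h.2,
      fun h => ⟨hab.of_mem_six h, tri_of_mem_six h⟩⟩

theorem special_mem_levelFuns (hj : j < k) : special k j ∈ levelFuns k j :=
  mem_levelFuns.2 ⟨_, _, level_special hj, rfl⟩

theorem smul_mem_levelFuns (u : (ZMod (3 ^ k))ˣ) {f : BoolFun (3 ^ k)} (hf : f ∈ levelFuns k j) :
    u • f ∈ levelFuns k j := by
  obtain ⟨a, b, h, rfl⟩ := mem_levelFuns.1 hf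
  rw [smul_tri]
  exact mem_levelFuns.2 ⟨_, _, h.unit_mul u, rfl⟩

/-- The orbit of `f` under the units. -/
abbrev orb (f : BoolFun (3 ^ k)) : Set (BoolFun (3 ^ k)) := MulAction.orbit (ZMod (3 ^ k))ˣ f

theorem ncard_orb_of_mem_levelFuns (hj : j < k) {f : BoolFun (3 ^ k)} (hf : f ∈ levelFuns k j) :
    orb f = orb (special k j) ∨ (1 ≤ j ∧ (orb f).ncard = 2 * 3 ^ j) := by
  obtain ⟨a, b, h, rfl⟩ := mem_levelFuns.1 hf
  by_cases hs : tri a b ∈ orb (special k j)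
  · exact .inl (MulAction.orbit_eq_iff.2 hs)
  · exact .inr (ncard_orbit_of_notMem hj h hs)

open scoped Classical in
/-- The classes of functions of level `j`. -/
noncomputable def levelClasses (k j : ℕ) : Finset (Set (BoolFun (3 ^ k))) :=
  (levelFuns k j).image orb

theorem sum_ncard_levelClasses : ∑ c ∈ levelClasses k j, c.ncard = #(levelFuns k j) := by
  classical
  rw [levelClasses, card_eq_sum_card_image orb]
  refine sum_congr rfl fun c hc => ?_
  obtain ⟨f, hf, rfl⟩ := mem_image.1 hc
  rw [← Set.ncard_coe_finset]
  congr 1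
  ext g
  simp only [coe_filter, Set.mem_ofPred_eq, MulAction.orbit_eq_iff]
  constructor
  · rintro ⟨u, rfl⟩
    exact ⟨smul_mem_levelFuns u hf, u, rfl⟩
  · exact fun h => h.2

theorem special_mem_levelClasses (hj : j < k) : orb (special k j) ∈ levelClasses k j :=
  mem_image_of_mem _ (special_mem_levelFuns hj)

theorem card_levelClasses (hj1 : 1 ≤ j) (hj : j < k) : #(levelClasses k j) = 2 * 3 ^ (j - 1) := by
  classical
  have hsum := sum_ncard_levelClasses (k := k) (j := j)
  rw [← add_sum_erase _ _ (special_mem_levelClasses hj), ncard_orbit_special hj,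
    sum_congr rfl (g := fun _ => 2 * 3 ^ j), sum_const, card_erase_of_mem (special_mem_levelClasses hj),
    smul_eq_mul] at hsum
  · have hpos : 0 < #(levelClasses k j) := card_pos.2 ⟨_, special_mem_levelClasses hj⟩
    have h6 := card_levelPairs_eq_mul (k := k) hj1
    have hc := card_levelPairs hj
    rw [h6, ← hsum] at hc
    obtain ⟨i, rfl⟩ := Nat.exists_eq_add_of_le' hj1
    obtain ⟨C, hC⟩ := Nat.exists_eq_add_of_le' hpos
    rw [hC] at hc ⊢
    simp only [Nat.add_sub_cancel] at hc ⊢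
    have hp : 1 ≤ 3 ^ i := Nat.one_le_pow _ _ (by norm_num)
    rw [pow_succ 3 (i + 1), pow_succ 3 i] at hc
    obtain ⟨t, ht⟩ : ∃ t, 3 ^ i = t := ⟨_, rfl⟩
    rw [ht] at hc hp ⊢
    zify [show 1 ≤ t * 3 by omega, show 2 ≤ t * 3 by omega, show 1 ≤ t * 3 * 3 by omega,
      show 2 ≤ t * 3 * 3 by omega] at hc hp ⊢
    -- Here t = `3 ^ (j - 1)` in the original j, and C counts the non-special classes: 6(3t + 6tC) =
    -- (9t - 1)(9t - 2) - (3t - 1)(3t - 2).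
    have : (36 * t : ℤ) * (C + 1 - 2 * t) = 0 := by linear_combination hc
    rcases mul_eq_zero.1 this with h | h
    · omega
    · omega
  · intro c hc
    obtain ⟨hne, hc⟩ := mem_erase.1 hc
    obtain ⟨f, hf, rfl⟩ := mem_image.1 hc
    exact ((ncard_orb_of_mem_levelFuns hj hf).resolve_left hne).2

theorem mem_equivClasses_iff (hk : 1 ≤ k) {c : Set (BoolFun (3 ^ k))} :
    c ∈ equivClasses (3 ^ k) ↔ ∃ j < k, c ∈ levelClasses k j := by
  have horb : ∀ f ∈ cubicMRS (3 ^ k), equivClass f = orb f := fun f hf =>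
    equivClass_eq_orbit (fun _ => affine_of_preserves_pow_three hk) hf
  constructor
  · rintro ⟨f, hf, rfl⟩
    rw [horb f hf]
    obtain ⟨a, b, hab, rfl⟩ := mem_cubicMRS.1 hf
    obtain ⟨j, hj, hl⟩ := exists_level hab
    exact ⟨j, hj, mem_image_of_mem _ (mem_levelFuns.2 ⟨_, _, hl, rfl⟩)⟩
  · rintro ⟨j, hj, hc⟩
    obtain ⟨f, hf, rfl⟩ := mem_image.1 hc
    obtain ⟨a, b, hl, rfl⟩ := mem_levelFuns.1 hf
    exact ⟨_, tri_mem_cubicMRS hl.1, horb _ (tri_mem_cubicMRS hl.1)⟩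

theorem ncard_of_mem_levelClasses (hj : j < k) {c : Set (BoolFun (3 ^ k))}
    (hc : c ∈ levelClasses k j) :
    c = orb (special k j) ∧ c.ncard = 3 ^ j ∨
      c ≠ orb (special k j) ∧ 1 ≤ j ∧ c.ncard = 2 * 3 ^ j := by
  obtain ⟨f, hf, rfl⟩ := mem_image.1 hc
  by_cases h : orb f = orb (special k j)
  · exact .inl ⟨h, by rw [h, ncard_orbit_special hj]⟩
  · exact .inr ⟨h, (ncard_orb_of_mem_levelFuns hj hf).resolve_left h⟩

/-- Parity separates special classes from the others, so the size of a class determines its level.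
-/
theorem three_pow_ne_two_mul (a b : ℕ) : 3 ^ a ≠ 2 * b := fun h => by
  have : Odd (3 ^ a) := Odd.pow (by decide)
  rw [h] at this
  exact (Nat.not_odd_iff_even.2 (even_two_mul b)) this

theorem eq_orb_special (hk : 1 ≤ k) {c : Set (BoolFun (3 ^ k))} (hc : c ∈ equivClasses (3 ^ k))
    (hcard : c.ncard = 3 ^ j) : c = orb (special k j) := by
  obtain ⟨l, hl, hcl⟩ := (mem_equivClasses_iff hk).1 hc
  rcases ncard_of_mem_levelClasses hl hcl with ⟨h1, h2⟩ | ⟨-, -, h2⟩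
  · rw [hcard] at h2
    rwa [Nat.pow_right_injective (by norm_num : 2 ≤ 3) h2]
  · exact absurd (hcard.symm.trans h2) (three_pow_ne_two_mul _ _)

theorem setOf_ncard_eq_two_mul (hk : 1 ≤ k) (hj : j < k) :
    {c ∈ equivClasses (3 ^ k) | c.ncard = 2 * 3 ^ j} =
      (levelClasses k j : Set (Set (BoolFun (3 ^ k)))) \ {orb (special k j)} := by
  ext c
  simp only [Set.mem_ofPred_eq, Set.mem_sdiff, mem_coe, Set.mem_singleton_iff]
  constructor
  · rintro ⟨hc, hcard⟩
    obtain ⟨l, hl, hcl⟩ := (mem_equivClasses_iff hk).1 hc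
    rcases ncard_of_mem_levelClasses hl hcl with ⟨-, h2⟩ | ⟨h1, -, h2⟩
    · exact absurd (h2.symm.trans hcard) (three_pow_ne_two_mul _ _)
    · rw [hcard] at h2
      obtain rfl := Nat.pow_right_injective (by norm_num : 2 ≤ 3) (Nat.eq_of_mul_eq_mul_left two_pos h2)
      exact ⟨hcl, h1⟩
  · rintro ⟨hc, hne⟩
    refine ⟨(mem_equivClasses_iff hk).2 ⟨j, hj, hc⟩, ?_⟩
    rcases ncard_of_mem_levelClasses hj hc with ⟨h, -⟩ | ⟨-, -, h⟩
    · exact absurd h hne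
    · exact h

theorem ncard_setOf_ncard_eq_two_mul (hj1 : 1 ≤ j) (hj : j < k) :
    {c ∈ equivClasses (3 ^ k) | c.ncard = 2 * 3 ^ j}.ncard = 2 * 3 ^ (j - 1) - 1 := by
  rw [setOf_ncard_eq_two_mul (by omega) hj,
    Set.ncard_sdiff_singleton_of_mem (special_mem_levelClasses hj), Set.ncard_coe_finset,
    card_levelClasses hj1 hj]

theorem numClasses_three_pow (hk : 1 ≤ k) : numClasses (3 ^ k) = 3 ^ (k - 1) := by
  classical
  have hunion : equivClasses (3 ^ k) = ((range k).biUnion (levelClasses k) :) := by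
    ext c
    simp [mem_equivClasses_iff hk]
  rw [numClasses, hunion, Set.ncard_coe_finset, card_biUnion]
  · have hsum : ∀ m < k, ∑ j ∈ range (m + 1), #(levelClasses k j) = 3 ^ m := by
      intro m
      induction m with
      | zero =>
        intro hm
        rw [zero_add, sum_range_one, pow_zero, card_eq_one]
        refine ⟨orb (special k 0), eq_singleton_iff_unique_mem.2
          ⟨special_mem_levelClasses hm, fun c hc => ?_⟩⟩
        rcases ncard_of_mem_levelClasses hm hc with ⟨h, -⟩ | ⟨-, h, -⟩
        · exact h
        · omega
      | succ m ih =>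
        intro hm
        rw [sum_range_succ, ih (by omega), card_levelClasses (by omega) hm, Nat.add_sub_cancel,
          pow_succ]
        ring
    have := hsum (k - 1) (by omega)
    rwa [Nat.sub_add_cancel hk] at this
  · intro i hi j hj hij
    rw [Function.onFun, disjoint_left]
    intro c hci hcj
    apply hij
    have key : ∀ a b : ℕ, 3 ^ a = 3 ^ b → a = b := fun a b =>
      fun h => Nat.pow_right_injective (by norm_num : 2 ≤ 3) h
    rcases ncard_of_mem_levelClasses (mem_range.1 hi) hci with ⟨-, h⟩ | ⟨-, -, h⟩ <;>
      rcases ncard_of_mem_levelClasses (mem_range.1 hj) hcj with ⟨-, h'⟩ | ⟨-, -, h'⟩ <;>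
      rw [h] at h'
    · exact key _ _ h'
    · exact absurd h' (three_pow_ne_two_mul _ _)
    · exact absurd h'.symm (three_pow_ne_two_mul _ _)
    · exact key _ _ (Nat.eq_of_mul_eq_mul_left two_pos h')

theorem exists_class_of_dvd (hk : 1 ≤ k) {d : ℕ} (hd : d ∣ Nat.totient (3 ^ k)) (hd2 : d ≠ 2) :
    ∃ c ∈ equivClasses (3 ^ k), c.ncard = d := by
  rw [Nat.totient_prime_pow Nat.prime_three hk, mul_comm, Nat.dvd_mul] at hd
  obtain ⟨e, t, he, ht, rfl⟩ := hd
  obtain ⟨j, hj, rfl⟩ := (Nat.dvd_prime_pow Nat.prime_three).1 ht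
  rcases (Nat.dvd_prime Nat.prime_two).1 he with rfl | rfl
  · exact ⟨orb (special k j),
      (mem_equivClasses_iff hk).2 ⟨j, by omega, special_mem_levelClasses (by omega)⟩,
      by rw [ncard_orbit_special (by omega), one_mul]⟩
  · have hj1 : 1 ≤ j := by
      by_contra h
      obtain rfl : j = 0 := by omega
      exact hd2 (by norm_num)
    have hcard := ncard_setOf_ncard_eq_two_mul (k := k) hj1 (by omega)
    have hp : 1 ≤ 3 ^ (j - 1) := Nat.one_le_pow _ _ (by norm_num)
    have hne : {c ∈ equivClasses (3 ^ k) | c.ncard = 2 * 3 ^ j}.Nonempty :=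
      Set.nonempty_of_ncard_ne_zero (by rw [hcard]; omega)
    exact hne

/-! ### Least representatives of the special classes -/

theorem special_eq_mrs (k j : ℕ) :
    special k j = mrs (3 ^ k) (3 ^ (k - 1 - j) + 1) (2 * 3 ^ (k - 1 - j) + 1) := by
  rw [special, mrs_eq_tri]
  apply tri_of_mem_six
  rw [mem_six]
  refine .inr (.inr (.inr (.inl ⟨?_, ?_⟩))) <;> push_cast <;> ring

theorem isLeastRepresentative_special (hj : j < k) :
    IsLeastRepresentative (orb (special k j)) (3 ^ (k - 1 - j) + 1) (2 * 3 ^ (k - 1 - j) + 1) := by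
  set g := 3 ^ (k - 1 - j) with hg
  have hg1 : 1 ≤ g := Nat.one_le_pow _ _ (by norm_num)
  have hgk : 3 * g ≤ 3 ^ k := by
    rw [hg, ← pow_succ']
    exact Nat.pow_le_pow_right (by norm_num) (by omega)
  -- Being killed by `3 ^ (j + 1)`, both offsets are multiples of g; they are positive and
  -- increasing, hence at least g and 2g.
  have hlow : ∀ t : ℕ ×ₗ ℕ, 1 < (ofLex t).1 → (ofLex t).1 < (ofLex t).2 → (ofLex t).2 ≤ 3 ^ k →
      mrs (3 ^ k) (ofLex t).1 (ofLex t).2 ∈ orb (special k j) →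
      toLex (g + 1, 2 * g + 1) ≤ t := by
    intro t h1 h2 h3 ⟨u, hu⟩
    change u • special k j = _ at hu
    rw [special, smul_tri, mrs_eq_tri] at hu
    have hm := mem_six_of_tri_eq (fun _ => two_mul_eq_zero)
      ((level_special hj).1.unit_mul u) (proper_of_lt h1 h2 h3) hu.symm
    have hkil := (((level_special hj).unit_mul u).of_mem_six hm).2.1
    have hdvd : ∀ m : ℕ, 1 ≤ m → 3 ^ (j + 1) * ((m : ZMod (3 ^ k)) - 1) = 0 → g ∣ m - 1 := by
      intro m hm h
      have h' : ((3 ^ (j + 1) * (m - 1) : ℕ) : ZMod (3 ^ k)) = 0 := by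
        push_cast [Nat.cast_sub hm]
        exact h
      have hpk : 3 ^ k = 3 ^ (j + 1) * g := by
        rw [hg, ← pow_add]
        congr 1
        omega
      rw [ZMod.natCast_eq_zero_iff] at h'
      exact Nat.dvd_of_mul_dvd_mul_left (pow_pos (by norm_num) _) (hpk ▸ h')
    obtain ⟨x, hx⟩ := hdvd _ h1.le hkil.1
    obtain ⟨y, hy⟩ := hdvd _ (h1.trans h2).le hkil.2
    have hx1 : 1 ≤ x := by
      rcases Nat.eq_zero_or_pos x with rfl | h
      · omega
      · exact h
    have hxy : x < y := by
      have : g * x < g * y := by omega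
      exact lt_of_mul_lt_mul_left this (by omega)
    have hgx : g * 1 ≤ g * x := Nat.mul_le_mul_left g hx1
    have hgy : g * 2 ≤ g * y := Nat.mul_le_mul_left g (by omega)
    rw [Prod.Lex.le_iff]
    simp only [ofLex_toLex]
    omega
  have hrep : toLex (g + 1, 2 * g + 1) ∈ representations (special k j) :=
    ⟨by simp; omega, by simp; omega, by simp; omega, (special_eq_mrs k j).symm⟩
  have hself : special k j ∈ orb (special k j) := MulAction.mem_orbit_self _
  constructor
  · refine ⟨⟨special k j, hrep, ?_⟩, ?_⟩
    · rintro t ⟨h1, h2, h3, h4⟩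
      exact hlow t h1 h2 h3 (h4 ▸ hself)
    · exact (special_eq_mrs k j).symm ▸ hself
  · rintro t ⟨⟨f, ⟨h1, h2, h3, -⟩, -⟩, h5⟩
    exact hlow t h1 h2 h3 h5

end Counting

theorem theorem5p7 (k : ℕ) (hk : 1 ≤ k) :
    numClasses (3 ^ k) = 3 ^ (k - 1) ∧
    (∀ d : ℕ, d ∣ Nat.totient (3 ^ k) → d ≠ 2 →
      ∃ c ∈ equivClasses (3 ^ k), c.ncard = d) ∧
    (¬ ∃ c ∈ equivClasses (3 ^ k), c.ncard = 2) ∧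
    (∀ j : ℕ, j ≤ k - 1 →
      ∃! c : Set (BoolFun (3 ^ k)), c ∈ equivClasses (3 ^ k) ∧ c.ncard = 3 ^ j) ∧
    (∀ j : ℕ, j ≤ k - 1 → ∀ c ∈ equivClasses (3 ^ k), c.ncard = 3 ^ j →
      IsLeastRepresentative c (3 ^ (k - j - 1) + 1) (2 * 3 ^ (k - j - 1) + 1)) ∧
    (∀ j : ℕ, 1 ≤ j → j ≤ k - 1 →
      {c ∈ equivClasses (3 ^ k) | c.ncard = 2 * 3 ^ j}.ncard = 2 * 3 ^ (j - 1) - 1) := by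
  refine ⟨numClasses_three_pow hk, fun d hd hd2 => exists_class_of_dvd hk hd hd2, ?_, ?_, ?_, ?_⟩
  · rintro ⟨c, hc, hcard⟩
    obtain ⟨j, hj, hcj⟩ := (mem_equivClasses_iff hk).1 hc
    rcases ncard_of_mem_levelClasses hj hcj with ⟨-, h⟩ | ⟨-, hj1, h⟩
    · exact three_pow_ne_two_mul j 1 (h.symm.trans hcard)
    · have : 3 ^ 1 ≤ 3 ^ j := Nat.pow_le_pow_right (by norm_num) hj1
      omega
  · intro j hj
    exact ⟨orb (special k j),
      ⟨(mem_equivClasses_iff hk).2 ⟨j, by omega, special_mem_levelClasses (by omega)⟩,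
        ncard_orbit_special (by omega)⟩, fun c hc => eq_orb_special hk hc.1 hc.2⟩
  · intro j hj c hc hcard
    rw [eq_orb_special hk hc hcard, show k - j - 1 = k - 1 - j by omega]
    exact isLeastRepresentative_special (by omega)
  · exact fun j hj1 hj => ncard_setOf_ncard_eq_two_mul hj1 (by omega)
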